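/- Let $V$ be a set of $n\ge 2$ nodes. An ordered constraint is an ordering $(v_1,\dots,v_s)$ of a subset of $V$ of size $s\ge 2$; a graph on $V$ satisfies it if for each $2\le i\le s$ it contains an edge $\{v_j,v_i\}$ for some $1\le j<i$. In Online Network Construction with Ordered Constraints, a sequence $\sigma$ of $r\ge 1$ ordered constraints arrives one by one, and the algorithm must add edges (which can never be removed) so that each constraint is satisfied when it arrives. Let $\mathrm{OPT}(\sigma)$ be the least number of edges of a graph that satisfies all constraints of $\sigma$. A randomized online algorithm is $\gamma$-competitive against an oblivious adversary if on each fixed sequence $\sigma$ of $r$ constraints, chosen independently of its random bits, its expected number of edges is at most $\gamma\cdot\mathrm{OPT}(\sigma)$. **Theorem.** For given $n\ge 2$ and $r\ge 1$ there is an $O\big((\log r+\log n)\log n\big)$-competitive randomized online algorithm for this problem against an oblivious adversary. More precisely, there is an absolute constant $K>0$ such that for each $c>1$ there is a constant $C>0$, depending only on $c$, with the following properties for all $n\ge 2$. (1) In online Fractional Network Construction, subsets $S_1,S_2,\dots$ of $V$ arrive one by one, and nonnegative edge weights $w_e$, which may only increase, must be maintained such that for each $S_i$ that has arrived, the maximum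 flow inside $S_i$, with edge capacities $w$, between each two vertices of $S_i$ is at least $1$. For this problem there is a deterministic online algorithm $F$ whose total weight $\sum_e w_e$ is at all times at most $K\log n$ times that of each fractional solution for the sets that have arrived. (2) Let $r\ge1$ and $t=\lceil c(\log n+\log r)\rceil$. Feed each arriving ordered constraint $(v_1,\dots,v_s)$ to $F$ as the sequence of sets $\{v_1,v_2\},\dots,\{v_1,\dots,v_s\}$. For each edge $e$ draw independent uniform $X(e,1),\dots,X(e,t)\in[0,1]$, and let $T(e)=\min_i X(e,i)$. The rounded solution consists at each time of the edges $e$ with $w_e\ge T(e)$. On each fixed sequence of $r$ ordered constraints, the rounded solution satisfies, at all times, all constraints that have arrived, with probability at least $1-(rn)^{-(c-1)}$. There is a randomized online algorithm, with the $X(e,i)$ as its only random bits, that satisfies every constraint on arrival for every outcome of the $X(e,i)$, always holds all edges of the rounded solution, holds exactly these edges as long as the rounded solution has at all times satisfied the constraints that had arrived, and is $C(\log r+\log n)\log n$-competitive on sequences of $r$ constraints against an oblivious adversary. -/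

import Mathlib

open MeasureTheory

namespace NetworkConstruction

/-- An ordered constraint on the nodes `Fin n`: an ordering `node 0, node 1, …, node (len - 1)`
of a subset of the nodes of size `len ≥ 2`. -/
structure OrderedConstraint (n : ℕ) where
  /-- the number of nodes in the constraint -/
  len : ℕ
  two_le_len : 2 ≤ len
  /-- the nodes, in the order of the constraint -/
  node : Fin len ↪ Fin n

/-- `G` satisfies `O` if every node of `O` except the first is joined in `G` to an earlier node
of `O`. -/
def OrderedConstraint.SatisfiedBy {n : ℕ} (O : OrderedConstraint n) (G : SimpleGraph (Fin n)) :
    Prop :=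
  ∀ i : Fin O.len, 0 < i.val → ∃ j : Fin O.len, j < i ∧ G.Adj (O.node j) (O.node i)

/-- `G` satisfies every constraint in the list `p`. -/
def Feasible {n : ℕ} (p : List (OrderedConstraint n)) (G : SimpleGraph (Fin n)) : Prop :=
  ∀ O ∈ p, O.SatisfiedBy G

/-- The cost of a solution: its number of edges. -/
noncomputable def cost {n : ℕ} (G : SimpleGraph (Fin n)) : ℕ := G.edgeSet.ncard

/-- The optimum in hindsight: the least number of edges of a graph that satisfies all the
constraints of `p` (the complete graph always does). -/
noncomputable def opt {n : ℕ} (p : List (OrderedConstraint n)) : ℕ :=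
  sInf {k : ℕ | ∃ G : SimpleGraph (Fin n), Feasible p G ∧ cost G = k}

/-! ### Randomized online algorithms -/

/-- A randomized online algorithm on `n` nodes with random seed in `Ω`. `graph p ω` is the graph
held after the constraints of `p` have arrived, in that order, when the seed is `ω`. It depends only
on what has arrived so far, edges are never removed, and every constraint is satisfied as soon as it
has arrived, whatever the seed. -/
structure RandomizedOnlineAlgorithm (n : ℕ) (Ω : Type) [MeasurableSpace Ω] where
  graph : List (OrderedConstraint n) → Ω → SimpleGraph (Fin n)
  mono : ∀ (p : List (OrderedConstraint n)) (O : OrderedConstraint n) (ω : Ω),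
    graph p ω ≤ graph (p ++ [O]) ω
  feasible : ∀ (p : List (OrderedConstraint n)) (ω : Ω), Feasible p (graph p ω)
  measurable : ∀ (p : List (OrderedConstraint n)) (G : SimpleGraph (Fin n)),
    MeasurableSet {ω | graph p ω = G}

/-- The algorithm is `c`-competitive against an oblivious adversary on sequences of `r` constraints:
for each fixed sequence of that length, chosen before the seed is drawn from `μ`, the expected
number of edges is at most `c` times the optimum in hindsight. -/
def RandomizedOnlineAlgorithm.IsCompetitive {n : ℕ} {Ω : Type} [MeasurableSpace Ω]
    (A : RandomizedOnlineAlgorithm n Ω) (μ : Measure Ω) (r : ℕ) (c : ℝ) : Prop :=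
  ∀ σ : List (OrderedConstraint n), σ.length = r →
    Integrable (fun ω => (cost (A.graph σ ω) : ℝ)) μ ∧
      ∫ ω, (cost (A.graph σ ω) : ℝ) ∂μ ≤ c * (opt σ : ℝ)

/-! ### The fractional problem -/

/-- `f` is a flow from `u` to `v` inside the vertex set `S`, with undirected edge capacities `w`;
`f x y` is the net flow from `x` to `y`. -/
structure IsFlow {n : ℕ} (w : Sym2 (Fin n) → ℝ) (S : Finset (Fin n)) (u v : Fin n)
    (f : Fin n → Fin n → ℝ) : Prop where
  antisymm : ∀ x y, f y x = -f x y
  capacity : ∀ x y, f x y ≤ w s(x, y)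
  support : ∀ x y, f x y ≠ 0 → x ∈ S ∧ y ∈ S
  conservation : ∀ x, x ≠ u → x ≠ v → ∑ y, f x y = 0

/-- Under the edge weights `w`, the maximum flow between each two vertices of `S`, inside `S`, is at
least `1`. -/
def FracFeasible {n : ℕ} (w : Sym2 (Fin n) → ℝ) (S : Finset (Fin n)) : Prop :=
  ∀ u ∈ S, ∀ v ∈ S, u ≠ v → ∃ f, IsFlow w S u v f ∧ 1 ≤ ∑ y, f u y

/-- The cost of a fractional solution: the sum of the weights of all the edges (not of loops). -/
noncomputable def fracCost {n : ℕ} (w : Sym2 (Fin n) → ℝ) : ℝ :=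
  ∑ e ∈ (⊤ : SimpleGraph (Fin n)).edgeFinset, w e

/-- A deterministic online algorithm for Fractional Network Construction, where vertex sets arrive
one by one: the nonnegative weights depend only on the sets that have arrived, never decrease, and
are feasible for each set that has arrived. -/
structure OnlineFractionalAlgorithm (n : ℕ) where
  weight : List (Finset (Fin n)) → Sym2 (Fin n) → ℝ
  nonneg : ∀ p e, 0 ≤ weight p e
  mono : ∀ p S e, weight p e ≤ weight (p ++ [S]) e
  feasible : ∀ p, ∀ S ∈ p, FracFeasible (weight p) S

/-- The cost of the algorithm is at all times at most `c` times that of any fractional solution for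
the sets that have arrived, hence at most `c` times the fractional optimum. -/
def OnlineFractionalAlgorithm.IsCompetitive {n : ℕ} (F : OnlineFractionalAlgorithm n) (c : ℝ) :
    Prop :=
  ∀ (p : List (Finset (Fin n))) (w : Sym2 (Fin n) → ℝ), (∀ e, 0 ≤ w e) →
    (∀ S ∈ p, FracFeasible w S) → fracCost (F.weight p) ≤ c * fracCost w

/-! ### Rounding -/

/-- The connectivity constraints `{node 0, …, node i}`, `1 ≤ i < len`, in increasing order of `i`,
that are together equivalent to the ordered constraint `O`. -/
def OrderedConstraint.connectivity {n : ℕ} (O : OrderedConstraint n) : List (Finset (Fin n)) :=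
  ((List.finRange O.len).filter (fun i => 0 < i.val)).map
    (fun i => (Finset.Iic i).map O.node)

/-- The weights held by `F` after the ordered constraints of `p` have been fed to it, each as its
sequence of connectivity constraints. -/
def OnlineFractionalAlgorithm.orderedWeight {n : ℕ} (F : OnlineFractionalAlgorithm n)
    (p : List (OrderedConstraint n)) : Sym2 (Fin n) → ℝ :=
  F.weight (p.flatMap OrderedConstraint.connectivity)

/-- The random numbers `X e i`, for each edge `e` and `i < t`. The canonical `volume` on this space
is the product of the uniform distributions on `[0, 1]`: the `X e i` are independent and uniform.
(The coordinates at loops are never used.) -/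
abbrev Seed (n t : ℕ) : Type := Sym2 (Fin n) → Fin t → unitInterval

/-- The threshold of the edge `e`: the minimum of the `X e i` (used for `t > 0` only). -/
noncomputable def threshold {n t : ℕ} (X : Seed n t) (e : Sym2 (Fin n)) : ℝ :=
  ⨅ i : Fin t, (X e i : ℝ)

/-- The rounded solution after `p`: all edges `e` whose weight has reached their threshold. -/
noncomputable def OnlineFractionalAlgorithm.rounded {n t : ℕ} (F : OnlineFractionalAlgorithm n)
    (p : List (OrderedConstraint n)) (X : Seed n t) : SimpleGraph (Fin n) :=
  SimpleGraph.fromEdgeSet {e | threshold X e ≤ F.orderedWeight p e}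

/-- Rounding alone has succeeded up to now: at each time during `p`, the rounded solution satisfied
all the constraints that had arrived. -/
def OnlineFractionalAlgorithm.RoundingSucceeds {n t : ℕ} (F : OnlineFractionalAlgorithm n)
    (p : List (OrderedConstraint n)) (X : Seed n t) : Prop :=
  ∀ q : List (OrderedConstraint n), q <+: p → Feasible q (F.rounded q X)

/-- `A` rounds `F` with the thresholds `threshold X`: its graph always contains all the edges whose
weight has reached their threshold, and it contains no others unless rounding alone has failed to
satisfy some constraint. -/
def RandomizedOnlineAlgorithm.Rounds {n t : ℕ} (A : RandomizedOnlineAlgorithm n (Seed n t))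
    (F : OnlineFractionalAlgorithm n) : Prop :=
  ∀ (p : List (OrderedConstraint n)) (X : Seed n t),
    F.rounded p X ≤ A.graph p X ∧ (F.RoundingSucceeds p X → A.graph p X = F.rounded p X)

end NetworkConstruction

open NetworkConstruction

/-! By max-flow min-cut, a set is feasible for fractional weights exactly when each of its cuts has
weight at least 1 (`FracFeasible.one_le_cut`, `fracFeasible_of_one_le_cut`). The online algorithm
starts all edges at `1 / n ^ 2` and doubles the edges of a violated cut until none is left. A
doubling costs less than 1, whereas any feasible `w` pays at least 1 for it in the potential `∑ w e
* k e`, where `k e` counts the doublings of `e`. No weight passes 2, so `k e = O(log n)`, which is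
the competitive ratio.

For the rounding, the last node of each prefix of a constraint forms a cut, so the edges from it to
earlier nodes have total weight at least 1. All of them miss their thresholds with probability at
most `exp (-t)`, by independence and `1 - a ≤ exp (-a)`. A union bound over at most `r * n` pairs of
a constraint and a node bounds the failure probability by `r * n * exp (-t)`, and the choice of `t`
makes this at most `(r * n) ^ (1 - c)`.

An uncovered node is repaired by one edge to the first node of its constraint. Thus feasibility is
certain, nothing is added while rounding succeeds, and the repairs cost at most `r * n * exp (-t) ≤
1 ≤ OPT` in expectation. An edge is rounded up with probability at most `t` times its weight, and a
graph satisfying the constraints is itself a fractional solution, so the total is `O(t log n)` times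
`OPT`. -/

namespace NetworkConstruction

variable {n : ℕ}

/-! ### Flows and cuts -/

/-- The edges that join `A` to the rest of `S`. -/
def cutEdges (S A : Finset (Fin n)) : Finset (Sym2 (Fin n)) :=
  (A ×ˢ (S \ A)).image (fun p => s(p.1, p.2))

lemma mem_cutEdges {S A : Finset (Fin n)} {e : Sym2 (Fin n)} :
    e ∈ cutEdges S A ↔ ∃ x ∈ A, ∃ y ∈ S \ A, e = s(x, y) := by
  simp only [cutEdges, Finset.mem_image, Finset.mem_product, Prod.exists]
  constructor
  · rintro ⟨x, y, ⟨hx, hy⟩, rfl⟩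
    exact ⟨x, hx, y, hy, rfl⟩
  · rintro ⟨x, hx, y, hy, rfl⟩
    exact ⟨x, y, ⟨hx, hy⟩, rfl⟩

lemma cutEdges_subset (S A : Finset (Fin n)) :
    cutEdges S A ⊆ (⊤ : SimpleGraph (Fin n)).edgeFinset := by
  intro e he
  obtain ⟨x, hx, y, hy, rfl⟩ := mem_cutEdges.1 he
  simp only [SimpleGraph.mem_edgeFinset, SimpleGraph.mem_edgeSet, SimpleGraph.top_adj]
  rintro rfl
  exact (Finset.mem_sdiff.1 hy).2 hx

lemma sum_cutEdges (w : Sym2 (Fin n) → ℝ) (S A : Finset (Fin n)) :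
    ∑ e ∈ cutEdges S A, w e = ∑ x ∈ A, ∑ y ∈ S \ A, w s(x, y) := by
  rw [cutEdges, Finset.sum_image, Finset.sum_product]
  rintro ⟨x, y⟩ h ⟨x', y'⟩ h' heq
  simp only [Finset.coe_product, Set.mem_prod, Finset.mem_coe, Finset.mem_sdiff] at h h'
  rcases Sym2.eq_iff.1 heq with ⟨h1, h2⟩ | ⟨h1, h2⟩
  · exact Prod.ext h1 h2
  · simp only at h1 h2
    subst h1
    exact absurd h.1 h'.2.2

lemma cutEdges_compl {S A : Finset (Fin n)} (h : A ⊆ S) :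
    cutEdges S (S \ A) = cutEdges S A := by
  ext e
  simp only [mem_cutEdges, Finset.sdiff_sdiff_eq_self h]
  constructor
  · rintro ⟨x, hx, y, hy, rfl⟩
    exact ⟨y, hy, x, hx, Sym2.eq_swap⟩
  · rintro ⟨x, hx, y, hy, rfl⟩
    exact ⟨y, hy, x, hx, Sym2.eq_swap⟩

lemma sum_antisymm_eq_zero {f : Fin n → Fin n → ℝ} (hf : ∀ x y, f y x = -f x y)
    (A : Finset (Fin n)) : ∑ x ∈ A, ∑ y ∈ A, f x y = 0 := by
  have h : ∑ x ∈ A, ∑ y ∈ A, f x y = -∑ x ∈ A, ∑ y ∈ A, f x y := by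
    conv_lhs => rw [Finset.sum_comm]
    simp only [← Finset.sum_neg_distrib]
    exact Finset.sum_congr rfl fun x _ => Finset.sum_congr rfl fun y _ => hf x y
  linarith

/-- The value of a flow is the net flow over each cut that separates its ends. -/
lemma IsFlow.value_eq_cut {w : Sym2 (Fin n) → ℝ} {S : Finset (Fin n)} {u v : Fin n}
    {f : Fin n → Fin n → ℝ} (hf : IsFlow w S u v f) {A : Finset (Fin n)} (hu : u ∈ A)
    (hv : v ∉ A) : ∑ y, f u y = ∑ x ∈ A, ∑ y ∈ S \ A, f x y := by
  have h1 : ∑ x ∈ A, ∑ y, f x y = ∑ y, f u y := by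
    apply Finset.sum_eq_single_of_mem u hu
    intro x hx hxu
    exact hf.conservation x hxu (fun h => hv (h ▸ hx))
  have h2 : ∀ x, ∑ y, f x y = ∑ y ∈ A, f x y + ∑ y ∈ S \ A, f x y := by
    intro x
    rw [← Finset.sum_add_sum_compl A]
    congr 1
    symm
    apply Finset.sum_subset
    · intro y hy
      simpa using (Finset.mem_sdiff.1 hy).2
    · intro y hy hy'
      by_contra h
      exact hy' (Finset.mem_sdiff.2 ⟨(hf.support x y h).2, by simpa using hy⟩)
  rw [← h1]
  simp only [h2, Finset.sum_add_distrib, sum_antisymm_eq_zero hf.antisymm, zero_add]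

lemma FracFeasible.one_le_cut {w : Sym2 (Fin n) → ℝ} {S : Finset (Fin n)}
    (h : FracFeasible w S) {A : Finset (Fin n)} (hAS : A ⊆ S) (hA : A.Nonempty)
    (hA' : (S \ A).Nonempty) : 1 ≤ ∑ e ∈ cutEdges S A, w e := by
  obtain ⟨u, hu⟩ := hA
  obtain ⟨v, hv⟩ := hA'
  rw [Finset.mem_sdiff] at hv
  obtain ⟨f, hf, h1⟩ := h u (hAS hu) v hv.1 (fun h => hv.2 (h ▸ hu))
  rw [hf.value_eq_cut hu hv.2] at h1
  rw [sum_cutEdges]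
  exact h1.trans (Finset.sum_le_sum fun x _ => Finset.sum_le_sum fun y _ => hf.capacity x y)

lemma isCompact_setOf_isFlow (w : Sym2 (Fin n) → ℝ) (S : Finset (Fin n)) (u v : Fin n) :
    IsCompact {f : Fin n → Fin n → ℝ | IsFlow w S u v f} := by
  have hK : IsCompact (Set.pi Set.univ fun x : Fin n => Set.pi Set.univ fun y : Fin n =>
      Set.Icc (-w s(y, x)) (w s(x, y))) :=
    isCompact_univ_pi fun x => isCompact_univ_pi fun y => isCompact_Icc
  refine hK.of_isClosed_subset ?_ ?_
  · have : {f : Fin n → Fin n → ℝ | IsFlow w S u v f} =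
        {f | (∀ x y, f y x = -f x y) ∧ (∀ x y, f x y ≤ w s(x, y)) ∧
          (∀ x y, ¬ (x ∈ S ∧ y ∈ S) → f x y = 0) ∧
          ∀ x, x ≠ u → x ≠ v → ∑ y, f x y = 0} := by
      ext f
      refine ⟨fun h => ⟨h.1, h.2, fun x y hxy => ?_, h.4⟩, fun h => ⟨h.1, h.2.1, fun x y hxy => ?_,
        h.2.2.2⟩⟩
      · by_contra h0
        exact hxy (h.3 x y h0)
      · by_contra h0
        exact hxy (h.2.2.1 x y h0)
    rw [this]
    simp only [Set.ofPred_and, Set.ofPred_forall]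
    refine IsClosed.inter ?_ (IsClosed.inter ?_ (IsClosed.inter ?_ ?_))
    · exact isClosed_iInter fun x => isClosed_iInter fun y =>
        isClosed_eq (by fun_prop) (by fun_prop)
    · exact isClosed_iInter fun x => isClosed_iInter fun y =>
        isClosed_le (by fun_prop) (by fun_prop)
    · exact isClosed_iInter fun x => isClosed_iInter fun y => isClosed_iInter fun _ =>
        isClosed_eq (by fun_prop) (by fun_prop)
    · exact isClosed_iInter fun x => isClosed_iInter fun _ => isClosed_iInter fun _ =>
        isClosed_eq (by fun_prop) (by fun_prop)
  · intro f hf x _ y _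
    have h1 := hf.capacity y x
    rw [hf.antisymm x y] at h1
    exact ⟨by linarith, hf.capacity x y⟩

/-- The unit flow along the single arc from `a` to `b`. -/
def arcFlow (a b x y : Fin n) : ℝ :=
  (if x = a ∧ y = b then 1 else 0) - (if x = b ∧ y = a then 1 else 0)

lemma sum_arcFlow (a b x : Fin n) :
    ∑ y, arcFlow a b x y = (if x = a then 1 else 0) - (if x = b then 1 else 0) := by
  have h : ∀ a b : Fin n, ∑ y, (if x = a ∧ y = b then (1 : ℝ) else 0) = if x = a then 1 else 0 := by
    intro a b
    by_cases h : x = a <;> simp [h]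
  simp only [arcFlow, Finset.sum_sub_distrib, h]

/-- Each vertex that can be reached from `u` through arcs with residual capacity can receive
more flow from `u`. -/
lemma exists_augmentation {w : Sym2 (Fin n) → ℝ} {S : Finset (Fin n)} {f : Fin n → Fin n → ℝ}
    (cap : ∀ x y, f x y ≤ w s(x, y)) {u v : Fin n}
    (h : Relation.ReflTransGen (fun x y => x ∈ S ∧ y ∈ S ∧ f x y < w s(x, y)) u v) :
    ∃ ε : ℝ, 0 < ε ∧ ∃ g : Fin n → Fin n → ℝ, (∀ x y, g y x = -g x y) ∧
      (∀ x y, g x y ≠ 0 → x ∈ S ∧ y ∈ S) ∧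
      (∀ x, ∑ y, g x y = (if x = u then 1 else 0) - (if x = v then 1 else 0)) ∧
      ∀ x y, f x y + ε * g x y ≤ w s(x, y) := by
  induction h with
  | refl => exact ⟨1, one_pos, 0, by simp, by simp, by simp, by simpa using cap⟩
  | @tail a b _ hab ih =>
    obtain ⟨ε, hε, g, hanti, hsupp, hdiv, hcap⟩ := ih
    obtain ⟨ha, hb, hlt⟩ := hab
    have hδ : 0 < w s(a, b) - f a b := by linarith
    -- With this half, `f + η * (g + arcFlow a b)` is the average of `f + 2 * η * g` and `f + 2 * η
    -- * arcFlow a b`, and each of these two respects the capacities.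
    set η := min ε (w s(a, b) - f a b) / 2 with hη
    have hη0 : 0 < η := half_pos (lt_min hε hδ)
    have hη1 : 2 * η ≤ ε := by rw [hη]; linarith [min_le_left ε (w s(a, b) - f a b)]
    have hη2 : 2 * η ≤ w s(a, b) - f a b := by
      rw [hη]; linarith [min_le_right ε (w s(a, b) - f a b)]
    have key1 : ∀ x y, f x y + 2 * η * g x y ≤ w s(x, y) := by
      intro x y
      rcases le_total 0 (g x y) with h | h
      · nlinarith [hcap x y]
      · nlinarith [cap x y]
    have key2 : ∀ x y, f x y + 2 * η * arcFlow a b x y ≤ w s(x, y) := by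
      intro x y
      by_cases h1 : x = a ∧ y = b
      · obtain ⟨rfl, rfl⟩ := h1
        have : arcFlow x y x y ≤ 1 := by
          simp only [arcFlow, and_self, if_true]
          split_ifs <;> norm_num
        nlinarith
      · have : arcFlow a b x y ≤ 0 := by
          simp only [arcFlow, h1, if_false]
          split_ifs <;> norm_num
        nlinarith [cap x y]
    refine ⟨η, hη0, fun x y => g x y + arcFlow a b x y, ?_, ?_, ?_, ?_⟩
    · intro x y
      have : arcFlow a b y x = -arcFlow a b x y := by
        simp only [arcFlow, and_comm]; ring
      simp only [hanti x y, this]; ring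
    · intro x y hxy
      by_cases hg : g x y = 0
      · have h2 : arcFlow a b x y ≠ 0 := by simpa [hg] using hxy
        by_cases h1 : x = a ∧ y = b
        · exact ⟨h1.1 ▸ ha, h1.2 ▸ hb⟩
        · by_cases h3 : x = b ∧ y = a
          · exact ⟨h3.1 ▸ hb, h3.2 ▸ ha⟩
          · simp [arcFlow, h1, h3] at h2
      · exact hsupp x y hg
    · intro x
      rw [Finset.sum_add_distrib, hdiv, sum_arcFlow]; ring
    · intro x y
      nlinarith [key1 x y, key2 x y]

/-- Max-flow min-cut: if each cut of `S` has weight at least `1`, so has each maximum flow. -/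
lemma fracFeasible_of_one_le_cut {w : Sym2 (Fin n) → ℝ} (hw : ∀ e, 0 ≤ w e)
    {S : Finset (Fin n)}
    (h : ∀ A ⊆ S, A.Nonempty → (S \ A).Nonempty → 1 ≤ ∑ e ∈ cutEdges S A, w e) :
    FracFeasible w S := by
  classical
  intro u hu v hv huv
  have hne : {f : Fin n → Fin n → ℝ | IsFlow w S u v f}.Nonempty :=
    ⟨0, by simp, fun x y => hw _, by simp, by simp⟩
  obtain ⟨f, hf, hmax⟩ := (isCompact_setOf_isFlow w S u v).exists_isMaxOn hne
    (f := fun f => ∑ y, f u y) (by fun_prop)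
  refine ⟨f, hf, ?_⟩
  -- The vertices reachable from `u` in the residual graph of a maximum flow. If `v` were among
  -- them, the flow could be augmented; otherwise they form a saturated cut.
  let R := Relation.ReflTransGen (fun x y => x ∈ S ∧ y ∈ S ∧ f x y < w s(x, y)) u
  have hvR : ¬ R v := by
    intro hR
    obtain ⟨ε, hε, g, hanti, hsupp, hdiv, hcap⟩ := exists_augmentation hf.capacity hR
    have hflow : IsFlow w S u v (fun x y => f x y + ε * g x y) := by
      refine ⟨?_, hcap, ?_, ?_⟩
      · intro x y
        rw [hf.antisymm x y, hanti x y]; ring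
      · intro x y hxy
        by_cases hg : g x y = 0
        · exact hf.support x y (by simpa [hg] using hxy)
        · exact hsupp x y hg
      · intro x hxu hxv
        rw [Finset.sum_add_distrib, ← Finset.mul_sum, hf.conservation x hxu hxv, hdiv]
        simp [hxu, hxv]
    have hle := hmax hflow
    simp only [Set.mem_ofPred_eq, Finset.sum_add_distrib, ← Finset.mul_sum, hdiv] at hle
    simp only [if_true, huv, if_false] at hle
    linarith
  let A := S.filter R
  have huA : u ∈ A := Finset.mem_filter.2 ⟨hu, Relation.ReflTransGen.refl⟩
  have hvA : v ∉ A := fun h => hvR (Finset.mem_filter.1 h).2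
  have hcut := h A (Finset.filter_subset _ _) ⟨u, huA⟩ ⟨v, Finset.mem_sdiff.2 ⟨hv, hvA⟩⟩
  rw [hf.value_eq_cut huA hvA]
  rw [sum_cutEdges] at hcut
  refine hcut.trans (Finset.sum_le_sum fun x hx => Finset.sum_le_sum fun y hy => ?_)
  obtain ⟨hxS, hxR⟩ := Finset.mem_filter.1 hx
  obtain ⟨hyS, hyA⟩ := Finset.mem_sdiff.1 hy
  by_contra hlt
  exact hyA (Finset.mem_filter.2 ⟨hyS, hxR.tail ⟨hxS, hyS, not_le.1 hlt⟩⟩)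

/-! ### The doubling algorithm -/

/-- An invariant that can be maintained one item at a time can be maintained by a monotone
function of the list of items. -/
lemma exists_online {α β : Type*} [Preorder β] (P : List α → β → Prop) (b₀ : β) (h₀ : P [] b₀)
    (step : ∀ p b a, P p b → ∃ b', b ≤ b' ∧ P (p ++ [a]) b') :
    ∃ f : List α → β, ∀ p, P p (f p) ∧ ∀ a, f p ≤ f (p ++ [a]) := by
  choose! g hg using step
  let f : List α → β := fun p => p.reverse.rec b₀ fun a l b => g l.reverse b a
  have hf : ∀ p a, f (p ++ [a]) = g p (f p) a := by
    intro p a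
    simp [f]
  have hP : ∀ p, P p (f p) := by
    intro p
    induction p using List.reverseRecOn with
    | nil => exact h₀
    | append_singleton p a ih => rw [hf]; exact (hg p (f p) a ih).2
  exact ⟨f, fun p => ⟨hP p, fun a => by rw [hf]; exact (hg p (f p) a (hP p)).1⟩⟩

/-- The weight of an edge that started at `1 / n ^ 2` and has been doubled `k` times. -/
noncomputable def doubledWeight (n k : ℕ) : ℝ := 2 ^ k / (n : ℝ) ^ 2

lemma doubledWeight_nonneg (n k : ℕ) : 0 ≤ doubledWeight n k := by
  unfold doubledWeight; positivity

lemma doubledWeight_mono {k l : ℕ} (h : k ≤ l) : doubledWeight n k ≤ doubledWeight n l := by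
  unfold doubledWeight
  gcongr
  norm_num

lemma doubledWeight_succ (n k : ℕ) : doubledWeight n (k + 1) = 2 * doubledWeight n k := by
  unfold doubledWeight
  rw [pow_succ]; ring

/-- The invariant of the doubling algorithm: no weight exceeds `2`, and after `N` doubling steps
the cost is at most `1 + N`, while each fractional solution has cut `N` times at least one unit. -/
def DoublingInvariant (p : List (Finset (Fin n))) (k : Sym2 (Fin n) → ℕ) : Prop :=
  (∀ e, doubledWeight n (k e) ≤ 2) ∧
    ∃ N : ℕ, fracCost (fun e => doubledWeight n (k e)) ≤ 1 + N ∧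
      ∀ w : Sym2 (Fin n) → ℝ, (∀ e, 0 ≤ w e) → (∀ S ∈ p, FracFeasible w S) →
        (N : ℝ) ≤ fracCost fun e => w e * k e

lemma card_edgeFinset_le (n : ℕ) :
    ((⊤ : SimpleGraph (Fin n)).edgeFinset.card : ℝ) ≤ (n : ℝ) ^ 2 := by
  rw [SimpleGraph.card_edgeFinset_top_eq_card_choose_two, Fintype.card_fin]
  exact_mod_cast Nat.choose_le_pow n 2

lemma doublingInvariant_nil (hn : 2 ≤ n) : DoublingInvariant (n := n) [] 0 := by
  have hn' : (2 : ℝ) ≤ n := by exact_mod_cast hn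
  refine ⟨fun e => ?_, 0, ?_, ?_⟩
  · simp only [doubledWeight, Pi.zero_apply, pow_zero]
    rw [div_le_iff₀ (by positivity)]
    nlinarith
  · simp only [fracCost, doubledWeight, Pi.zero_apply, pow_zero, Finset.sum_const, nsmul_eq_mul]
    rw [mul_one_div, Nat.cast_zero, add_zero, div_le_one (by positivity)]
    exact card_edgeFinset_le n
  · intro w _ _
    simp [fracCost]

lemma DoublingInvariant.append {p : List (Finset (Fin n))} {k : Sym2 (Fin n) → ℕ}
    (h : DoublingInvariant p k) (S : Finset (Fin n)) : DoublingInvariant (p ++ [S]) k := by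
  obtain ⟨h1, N, h2, h3⟩ := h
  exact ⟨h1, N, h2, fun w hw hp => h3 w hw fun T hT => hp T (List.mem_append_left _ hT)⟩

/-- Doubling the weights over a cut of weight less than `1` maintains the invariant. -/
lemma DoublingInvariant.double {p : List (Finset (Fin n))} {k : Sym2 (Fin n) → ℕ}
    (h : DoublingInvariant p k) {S A : Finset (Fin n)} (hS : S ∈ p) (hAS : A ⊆ S)
    (hA : A.Nonempty) (hA' : (S \ A).Nonempty)
    (hlt : ∑ e ∈ cutEdges S A, doubledWeight n (k e) < 1) :
    DoublingInvariant p (fun e => k e + if e ∈ cutEdges S A then 1 else 0) := by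
  obtain ⟨h1, N, h2, h3⟩ := h
  have hadd : ∀ e, doubledWeight n (k e + if e ∈ cutEdges S A then 1 else 0) =
      doubledWeight n (k e) + if e ∈ cutEdges S A then doubledWeight n (k e) else 0 := by
    intro e
    split_ifs
    · rw [doubledWeight_succ]; ring
    · simp
  have hsum : ∀ v : Sym2 (Fin n) → ℝ, (∑ e ∈ (⊤ : SimpleGraph (Fin n)).edgeFinset,
      if e ∈ cutEdges S A then v e else 0) = ∑ e ∈ cutEdges S A, v e := by
    intro v
    rw [← Finset.sum_filter, Finset.filter_mem_eq_inter,
      Finset.inter_eq_right.2 (cutEdges_subset S A)]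
  -- A doubled edge lies in a cut of weight below 1, so it stays below 2. The cost grows by the
  -- weight of the cut, and `∑ w e * k e` by the weight of the cut under `w`.
  refine ⟨fun e => ?_, N + 1, ?_, fun w hw hp => ?_⟩
  · rw [hadd]
    split_ifs with he
    · have := Finset.single_le_sum (f := fun e => doubledWeight n (k e))
        (fun e _ => doubledWeight_nonneg n (k e)) he
      linarith
    · simpa using h1 e
  · simp only [fracCost, hadd, Finset.sum_add_distrib, hsum] at h2 ⊢
    push_cast
    linarith
  · have hcut := (hp S hS).one_le_cut hAS hA hA'
    have h3' := h3 w hw hp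
    simp only [fracCost] at h3' ⊢
    push_cast
    simp only [mul_add, Finset.sum_add_distrib, mul_ite, mul_one, mul_zero, hsum]
    linarith

/-- The cap of 2 on the weights bounds the exponents. This finiteness plays the role of termination
of the doubling loop. -/
lemma finite_setOf_doublingInvariant (hn : 2 ≤ n) (p : List (Finset (Fin n))) :
    {k : Sym2 (Fin n) → ℕ | DoublingInvariant p k}.Finite := by
  refine (Set.Finite.pi' fun _ : Sym2 (Fin n) => Set.finite_Iic (2 * n ^ 2)).subset ?_
  intro k hk e
  have h := hk.1 e
  rw [doubledWeight, div_le_iff₀ (by positivity)] at h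
  have h' : 2 ^ k e ≤ 2 * n ^ 2 := by exact_mod_cast h
  exact (Nat.lt_two_pow_self.le).trans h'

/-- A maximal exponent vector above `k` that keeps the invariant is feasible: a violated cut could
be doubled, giving a strictly larger one. -/
lemma DoublingInvariant.exists_feasible (hn : 2 ≤ n) {p : List (Finset (Fin n))}
    {k : Sym2 (Fin n) → ℕ} (h : DoublingInvariant p k) :
    ∃ k', k ≤ k' ∧ DoublingInvariant p k' ∧
      ∀ S ∈ p, FracFeasible (fun e => doubledWeight n (k' e)) S := by
  obtain ⟨k', hkk', hmax⟩ := (finite_setOf_doublingInvariant hn p).exists_le_maximal h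
  refine ⟨k', hkk', hmax.1, fun S hS => ?_⟩
  refine fracFeasible_of_one_le_cut (fun e => doubledWeight_nonneg n _) fun A hAS hA hA' => ?_
  by_contra hlt
  have hd := DoublingInvariant.double hmax.1 hS hAS hA hA' (not_le.1 hlt)
  have hle := hmax.2 hd fun e => Nat.le_add_right _ _
  obtain ⟨x, hx⟩ := hA
  obtain ⟨y, hy⟩ := hA'
  have := hle s(x, y)
  simp only [if_pos (mem_cutEdges.2 ⟨x, hx, y, hy, rfl⟩)] at this
  omega

/-- The cap reads `2 ^ k ≤ 2 * n ^ 2`, and the right side is at most `n ^ 3`. -/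
lemma natCast_le_log_of_doubledWeight_le (hn : 2 ≤ n) {k : ℕ} (h : doubledWeight n k ≤ 2) :
    (k : ℝ) ≤ 3 / Real.log 2 * Real.log n := by
  have hn' : (2 : ℝ) ≤ n := by exact_mod_cast hn
  have hlog2 : 0 < Real.log 2 := Real.log_pos (by norm_num)
  rw [doubledWeight, div_le_iff₀ (by positivity)] at h
  have h' := Real.log_le_log (by positivity) h
  rw [Real.log_pow, Real.log_mul (by norm_num) (by positivity), Real.log_pow] at h'
  have h2 := Real.log_le_log (by norm_num) hn'
  rw [div_mul_eq_mul_div, le_div_iff₀ hlog2]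
  push_cast at h'
  linarith

lemma fracCost_nonneg {w : Sym2 (Fin n) → ℝ} (hw : ∀ e, 0 ≤ w e) : 0 ≤ fracCost w :=
  Finset.sum_nonneg fun e _ => hw e

lemma FracFeasible.one_le_fracCost {w : Sym2 (Fin n) → ℝ} (hw : ∀ e, 0 ≤ w e)
    {S : Finset (Fin n)} (hS : 2 ≤ S.card) (h : FracFeasible w S) : 1 ≤ fracCost w := by
  obtain ⟨u, hu, v, hv, huv⟩ := Finset.one_lt_card.1 hS
  refine (h.one_le_cut (A := {u}) (by simpa using hu) ⟨u, by simp⟩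
    ⟨v, by simp [hv, huv.symm]⟩).trans ?_
  exact Finset.sum_le_sum_of_subset_of_nonneg (cutEdges_subset _ _) fun e _ _ => hw e

/-- The doubling algorithm is `O(log n)`-competitive for Fractional Network Construction. -/
theorem exists_competitive_fractional (hn : 2 ≤ n) :
    ∃ F : OnlineFractionalAlgorithm n, F.IsCompetitive (4 / Real.log 2 * Real.log n) := by
  classical
  obtain ⟨k, hk⟩ := exists_online (fun (p : List (Finset (Fin n))) (k : Sym2 (Fin n) → ℕ) =>
    DoublingInvariant p k ∧ ∀ S ∈ p, FracFeasible (fun e => doubledWeight n (k e)) S) 0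
    ⟨doublingInvariant_nil hn, by simp⟩ (fun p k S h => by
      obtain ⟨k', h1, h2⟩ := (h.1.append S).exists_feasible hn
      exact ⟨k', h1, h2⟩)
  -- As long as only sets with fewer than two vertices have arrived, the zero solution is feasible,
  -- so the initial weights must not yet be charged. From then on every solution costs at least 1,
  -- which pays for the initial cost.
  let weight : List (Finset (Fin n)) → Sym2 (Fin n) → ℝ := fun p e =>
    if ∃ S ∈ p, 2 ≤ S.card then doubledWeight n (k p e) else 0
  have hpos : ∀ {p}, (∃ S ∈ p, 2 ≤ S.card) → weight p = fun e => doubledWeight n (k p e) :=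
    fun h => funext fun e => if_pos h
  have hneg : ∀ {p}, (¬ ∃ S ∈ p, 2 ≤ S.card) → weight p = 0 := fun h => funext fun e => if_neg h
  have hnonneg : ∀ p e, 0 ≤ weight p e := by
    intro p e
    by_cases h : ∃ S ∈ p, 2 ≤ S.card
    · rw [hpos h]; exact doubledWeight_nonneg _ _
    · rw [hneg h]; rfl
  refine ⟨⟨weight, hnonneg, ?_, ?_⟩, ?_⟩
  · intro p S e
    by_cases h : ∃ S ∈ p, 2 ≤ S.card
    · have h' : ∃ T ∈ p ++ [S], 2 ≤ T.card := by
        obtain ⟨T, hT, hT2⟩ := h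
        exact ⟨T, List.mem_append_left _ hT, hT2⟩
      rw [hpos h, hpos h']
      exact doubledWeight_mono ((hk p).2 S e)
    · rw [hneg h]; exact hnonneg _ _
  · intro p S hS
    by_cases h : ∃ S ∈ p, 2 ≤ S.card
    · rw [hpos h]; exact (hk p).1.2 S hS
    · intro u hu v hv huv
      exact absurd ⟨S, hS, Finset.one_lt_card.2 ⟨u, hu, v, hv, huv⟩⟩ h
  · intro p w hw hp
    have hlog2 : 0 < Real.log 2 := Real.log_pos (by norm_num)
    have hlog : Real.log 2 ≤ Real.log n :=
      Real.log_le_log (by norm_num) (by exact_mod_cast hn)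
    change fracCost (weight p) ≤ _
    by_cases h : ∃ S ∈ p, 2 ≤ S.card
    · rw [hpos h]
      obtain ⟨h2, N, hN, hcut⟩ := (hk p).1.1
      obtain ⟨S, hS, hS2⟩ := h
      have hone := (hp S hS).one_le_fracCost hw hS2
      have hL : fracCost (fun e => w e * k p e) ≤ 3 / Real.log 2 * Real.log n * fracCost w := by
        simp only [fracCost, Finset.mul_sum]
        refine Finset.sum_le_sum fun e _ => ?_
        rw [mul_comm]
        exact mul_le_mul_of_nonneg_right (natCast_le_log_of_doubledWeight_le hn (h2 e)) (hw e)
      have hN' := hcut w hw hp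
      have hr : 1 ≤ 1 / Real.log 2 * Real.log n := by
        rw [div_mul_eq_mul_div, le_div_iff₀ hlog2]; linarith
      have : 4 / Real.log 2 * Real.log n * fracCost w =
          3 / Real.log 2 * Real.log n * fracCost w + 1 / Real.log 2 * Real.log n * fracCost w := by
        ring
      nlinarith
    · rw [hneg h]
      have : fracCost (0 : Sym2 (Fin n) → ℝ) = 0 := by simp [fracCost]
      rw [this]
      have := fracCost_nonneg hw
      positivity

/-! ### Rounding the fractional solution -/

variable {t : ℕ}

lemma OrderedConstraint.len_le (O : OrderedConstraint n) : O.len ≤ n := by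
  simpa using Fintype.card_le_of_embedding O.node

lemma OrderedConstraint.SatisfiedBy.mono {O : OrderedConstraint n} {G H : SimpleGraph (Fin n)}
    (h : O.SatisfiedBy G) (hGH : G ≤ H) : O.SatisfiedBy H := fun i hi => by
  obtain ⟨j, hj, hadj⟩ := h i hi
  exact ⟨j, hj, hGH hadj⟩

lemma OrderedConstraint.mem_connectivity {O : OrderedConstraint n} {S : Finset (Fin n)} :
    S ∈ O.connectivity ↔ ∃ i : Fin O.len, 0 < i.val ∧ (Finset.Iic i).map O.node = S := by
  simp [OrderedConstraint.connectivity]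

lemma OnlineFractionalAlgorithm.weight_le_append (F : OnlineFractionalAlgorithm n)
    (p l : List (Finset (Fin n))) (e : Sym2 (Fin n)) : F.weight p e ≤ F.weight (p ++ l) e := by
  induction l using List.reverseRecOn with
  | nil => simp
  | append_singleton l S ih =>
    rw [← List.append_assoc]
    exact ih.trans (F.mono _ _ _)

lemma OnlineFractionalAlgorithm.rounded_le_append (F : OnlineFractionalAlgorithm n)
    (p : List (OrderedConstraint n)) (O : OrderedConstraint n) (X : Seed n t) :
    F.rounded p X ≤ F.rounded (p ++ [O]) X := by
  refine SimpleGraph.fromEdgeSet_mono fun e he => ?_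
  refine le_trans (Set.mem_ofPred_eq ▸ he) ?_
  simp only [OnlineFractionalAlgorithm.orderedWeight, List.flatMap_append]
  exact F.weight_le_append _ _ e

/-- Feasibility for the prefix ending at node `i`, applied to the cut that splits off this last
node. -/
lemma OnlineFractionalAlgorithm.one_le_sum_orderedWeight (F : OnlineFractionalAlgorithm n)
    {p : List (OrderedConstraint n)} {O : OrderedConstraint n} (hO : O ∈ p) {i : Fin O.len}
    (hi : 0 < i.val) :
    1 ≤ ∑ j ∈ Finset.Iio i, F.orderedWeight p s(O.node j, O.node i) := by
  have hmem : (Finset.Iic i).map O.node ∈ p.flatMap OrderedConstraint.connectivity :=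
    List.mem_flatMap.2 ⟨O, hO, OrderedConstraint.mem_connectivity.2 ⟨i, hi, rfl⟩⟩
  have hsdiff : (Finset.Iic i).map O.node \ (Finset.Iio i).map O.node = {O.node i} := by
    rw [← Finset.map_sdiff]
    have : Finset.Iic i \ Finset.Iio i = {i} := by
      ext j
      simp only [Finset.mem_sdiff, Finset.mem_Iic, Finset.mem_Iio, not_lt, Finset.mem_singleton]
      exact ⟨fun h => le_antisymm h.1 h.2, fun h => h ▸ ⟨le_rfl, le_rfl⟩⟩
    rw [this, Finset.map_singleton]
  have h := (F.feasible _ _ hmem).one_le_cut (A := (Finset.Iio i).map O.node)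
    (Finset.map_subset_map.2 Finset.Iio_subset_Iic_self)
    ⟨O.node ⟨0, hi.trans i.2⟩, Finset.mem_map_of_mem _ (Finset.mem_Iio.2 hi)⟩
    (hsdiff ▸ Finset.singleton_nonempty _)
  rw [sum_cutEdges, hsdiff] at h
  simp only [Finset.sum_map, Finset.sum_singleton] at h
  exact h

/-! ### Probabilities of threshold events -/

lemma bddBelow_seed (X : Seed n t) (e : Sym2 (Fin n)) :
    BddBelow (Set.range fun i : Fin t => (X e i : ℝ)) :=
  (Set.finite_range _).bddBelow

lemma threshold_le_iff (ht : 0 < t) (X : Seed n t) (e : Sym2 (Fin n)) (a : ℝ) :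
    threshold X e ≤ a ↔ ∃ i, (X e i : ℝ) ≤ a := by
  have : Nonempty (Fin t) := ⟨⟨0, ht⟩⟩
  constructor
  · intro h
    obtain ⟨i, hi⟩ := exists_eq_ciInf_of_finite (f := fun i : Fin t => (X e i : ℝ))
    exact ⟨i, hi.le.trans h⟩
  · rintro ⟨i, hi⟩
    exact (ciInf_le (bddBelow_seed X e) i).trans hi

lemma measurableSet_threshold_le (ht : 0 < t) (e : Sym2 (Fin n)) (a : ℝ) :
    MeasurableSet {X : Seed n t | threshold X e ≤ a} := by
  simp only [threshold_le_iff ht, Set.ofPred_exists]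
  exact MeasurableSet.iUnion fun i => measurableSet_le (by fun_prop) measurable_const

lemma volume_coe_le (a : ℝ) : volume {x : unitInterval | (x : ℝ) ≤ a} ≤ ENNReal.ofReal a := by
  by_cases h0 : 0 ≤ a
  · by_cases h1 : a ≤ 1
    · exact (unitInterval.volume_Iic ⟨a, h0, h1⟩).le
    · refine prob_le_one.trans ?_
      rw [ENNReal.one_le_ofReal]
      exact (not_le.1 h1).le
  · have : {x : unitInterval | (x : ℝ) ≤ a} = ∅ := by
      ext x
      simpa using (not_le.1 h0).trans_le x.2.1
    simp [this]

lemma volume_lt_coe_le {a : ℝ} (h0 : 0 ≤ a) :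
    volume {x : unitInterval | a < (x : ℝ)} ≤ ENNReal.ofReal (Real.exp (-a)) := by
  by_cases h1 : a ≤ 1
  · refine (unitInterval.volume_Ioi ⟨a, h0, h1⟩).le.trans (ENNReal.ofReal_le_ofReal ?_)
    have := Real.add_one_le_exp (-a)
    simp only
    linarith
  · have : {x : unitInterval | a < (x : ℝ)} = ∅ := by
      ext x
      simpa using x.2.2.trans (not_le.1 h1).le
    simp [this]

/-- Union bound over the `t` draws. -/
lemma measureReal_threshold_le (ht : 0 < t) (e : Sym2 (Fin n)) {a : ℝ} (ha : 0 ≤ a) :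
    (volume : Measure (Seed n t)).real {X | threshold X e ≤ a} ≤ t * a := by
  have h : {X : Seed n t | threshold X e ≤ a} =
      ⋃ i : Fin t, (fun X : Seed n t => X e i) ⁻¹' {x | (x : ℝ) ≤ a} := by
    ext X
    simp [threshold_le_iff ht]
  rw [h]
  refine (measureReal_iUnion_fintype_le _).trans ?_
  have hi : ∀ i : Fin t, (volume : Measure (Seed n t)).real
      ((fun X : Seed n t => X e i) ⁻¹' {x | (x : ℝ) ≤ a}) ≤ a := by
    intro i
    have hmp : MeasurePreserving (fun X : Seed n t => X e i) :=
      (measurePreserving_eval (fun _ : Fin t => (volume : Measure unitInterval)) i).comp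
        (measurePreserving_eval
          (fun _ : Sym2 (Fin n) => (volume : Measure (Fin t → unitInterval))) e)
    rw [measureReal_def, hmp.measure_preimage
      (measurableSet_le measurable_subtype_coe measurable_const).nullMeasurableSet]
    exact ENNReal.toReal_le_of_le_ofReal ha (volume_coe_le a)
  refine (Finset.sum_le_sum fun i _ => hi i).trans ?_
  simp

/-- Independence of the thresholds: edges of total weight at least `1` all stay below their
thresholds with probability at most `exp (-t)`. -/
lemma measureReal_forall_lt_threshold (ht : 0 < t) (w : Sym2 (Fin n) → ℝ) (hw : ∀ e, 0 ≤ w e)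
    (E : Finset (Sym2 (Fin n))) (hE : 1 ≤ ∑ e ∈ E, w e) :
    (volume : Measure (Seed n t)).real {X | ∀ e ∈ E, ¬ threshold X e ≤ w e} ≤ Real.exp (-t) := by
  classical
  -- The event is a box in the product space, so its measure factors; each edge of `E` contributes
  -- at most `exp (-(t * w e))`.
  have h : {X : Seed n t | ∀ e ∈ E, ¬ threshold X e ≤ w e} =
      Set.pi Set.univ fun e => if e ∈ E then
        Set.pi Set.univ fun _ : Fin t => {x : unitInterval | w e < (x : ℝ)} else Set.univ := by
    ext X
    simp only [threshold_le_iff ht, not_exists, not_le, Set.mem_ofPred_eq, Set.mem_pi,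
      Set.mem_univ, true_imp_iff]
    refine forall_congr' fun e => ?_
    by_cases he : e ∈ E <;> simp [he, Set.mem_pi]
  rw [h, measureReal_def]
  refine ENNReal.toReal_le_of_le_ofReal (Real.exp_nonneg _) ?_
  rw [volume_pi_pi]
  have hfac : ∀ e, volume (if e ∈ E then
      Set.pi Set.univ fun _ : Fin t => {x : unitInterval | w e < (x : ℝ)} else Set.univ) ≤
      if e ∈ E then ENNReal.ofReal (Real.exp (-(t * w e))) else 1 := by
    intro e
    split_ifs
    · rw [volume_pi_pi, Finset.prod_const, Finset.card_univ, Fintype.card_fin]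
      refine (pow_le_pow_left' (volume_lt_coe_le (hw e)) t).trans ?_
      rw [← ENNReal.ofReal_pow (Real.exp_nonneg _), ← Real.exp_nat_mul, mul_neg]
    · exact prob_le_one
  refine (Finset.prod_le_prod' fun e _ => hfac e).trans ?_
  rw [← Finset.prod_filter, Finset.filter_mem_eq_inter, Finset.univ_inter,
    ← ENNReal.ofReal_prod_of_nonneg fun e _ => Real.exp_nonneg _, ← Real.exp_sum]
  refine ENNReal.ofReal_le_ofReal (Real.exp_le_exp.2 ?_)
  rw [Finset.sum_neg_distrib, ← Finset.mul_sum]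
  have : (0 : ℝ) ≤ t := Nat.cast_nonneg t
  nlinarith

/-! ### Repairing failures of the rounded solution -/

/-- The event that no edge of the rounded solution after `q` joins the node `i` of `O` to an
earlier node of `O`. -/
def OnlineFractionalAlgorithm.uncovered (F : OnlineFractionalAlgorithm n) (t : ℕ)
    (q : List (OrderedConstraint n)) (O : OrderedConstraint n) (i : Fin O.len) :
    Set (Seed n t) :=
  {X | 0 < i.val ∧ ∀ j < i, ¬ (F.rounded q X).Adj (O.node j) (O.node i)}

lemma OnlineFractionalAlgorithm.adj_rounded (F : OnlineFractionalAlgorithm n)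
    (q : List (OrderedConstraint n)) (X : Seed n t) {x y : Fin n} :
    (F.rounded q X).Adj x y ↔ threshold X s(x, y) ≤ F.orderedWeight q s(x, y) ∧ x ≠ y := by
  rw [OnlineFractionalAlgorithm.rounded, SimpleGraph.fromEdgeSet_adj, Set.mem_ofPred_eq]

lemma OnlineFractionalAlgorithm.orderedWeight_nonneg (F : OnlineFractionalAlgorithm n)
    (p : List (OrderedConstraint n)) (e : Sym2 (Fin n)) : 0 ≤ F.orderedWeight p e :=
  F.nonneg _ e

lemma OnlineFractionalAlgorithm.measurableSet_adj_rounded (F : OnlineFractionalAlgorithm n)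
    (ht : 0 < t) (q : List (OrderedConstraint n)) (x y : Fin n) :
    MeasurableSet {X : Seed n t | (F.rounded q X).Adj x y} := by
  simp only [F.adj_rounded, Set.ofPred_and]
  exact (measurableSet_threshold_le ht _ _).inter (MeasurableSet.const _)

lemma OnlineFractionalAlgorithm.measurableSet_uncovered (F : OnlineFractionalAlgorithm n)
    (ht : 0 < t) (q : List (OrderedConstraint n)) (O : OrderedConstraint n) (i : Fin O.len) :
    MeasurableSet (F.uncovered t q O i) := by
  simp only [OnlineFractionalAlgorithm.uncovered, Set.ofPred_and, Set.ofPred_forall]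
  exact (MeasurableSet.const _).inter (MeasurableSet.iInter fun j => MeasurableSet.iInter fun _ =>
    (F.measurableSet_adj_rounded ht q _ _).compl)

lemma OnlineFractionalAlgorithm.measureReal_uncovered_le (F : OnlineFractionalAlgorithm n)
    (ht : 0 < t) {q : List (OrderedConstraint n)} {O : OrderedConstraint n} (hO : O ∈ q)
    (i : Fin O.len) : volume.real (F.uncovered t q O i) ≤ Real.exp (-t) := by
  by_cases hi : 0 < i.val
  · have hinj : Set.InjOn (fun j => s(O.node j, O.node i)) (Finset.Iio i : Set (Fin O.len)) := by
      intro j _ j' _ h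
      exact O.node.injective (Sym2.congr_left.1 h)
    refine le_trans (measureReal_mono ?_) (measureReal_forall_lt_threshold ht (F.orderedWeight q)
      (F.orderedWeight_nonneg q) ((Finset.Iio i).image fun j => s(O.node j, O.node i)) ?_)
    · rintro X ⟨-, hX⟩ e he
      obtain ⟨j, hj, rfl⟩ := Finset.mem_image.1 he
      have hj' := Finset.mem_Iio.1 hj
      exact fun h => hX j hj' ((F.adj_rounded q X).2 ⟨h, fun h => hj'.ne (O.node.injective h)⟩)
    · rw [Finset.sum_image hinj]
      exact F.one_le_sum_orderedWeight hO hi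
  · have : F.uncovered t q O i = ∅ := by
      ext X
      simp [OnlineFractionalAlgorithm.uncovered, hi]
    simp [this, Real.exp_nonneg]

/-- The edges that join the first node of `O` to each node of `O` that has no earlier neighbour in
the rounded solution after `q`. -/
def OnlineFractionalAlgorithm.repair (F : OnlineFractionalAlgorithm n)
    (q : List (OrderedConstraint n)) (O : OrderedConstraint n) (X : Seed n t) :
    SimpleGraph (Fin n) :=
  SimpleGraph.fromEdgeSet
    ((fun i => s(O.node ⟨0, two_pos.trans_le O.two_le_len⟩, O.node i)) ''
      {i | X ∈ F.uncovered t q O i})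

/-- All the repairs made during `p`, each on arrival of the constraint concerned. -/
def OnlineFractionalAlgorithm.repairs (F : OnlineFractionalAlgorithm n)
    (p : List (OrderedConstraint n)) (X : Seed n t) : SimpleGraph (Fin n) :=
  p.reverse.rec ⊥ fun O l G => G ⊔ F.repair (l.reverse ++ [O]) O X

lemma OnlineFractionalAlgorithm.repairs_nil (F : OnlineFractionalAlgorithm n) (X : Seed n t) :
    F.repairs [] X = ⊥ := rfl

lemma OnlineFractionalAlgorithm.repairs_append (F : OnlineFractionalAlgorithm n)
    (p : List (OrderedConstraint n)) (O : OrderedConstraint n) (X : Seed n t) :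
    F.repairs (p ++ [O]) X = F.repairs p X ⊔ F.repair (p ++ [O]) O X := by
  simp [OnlineFractionalAlgorithm.repairs]

lemma OnlineFractionalAlgorithm.measurableSet_adj_repairs (F : OnlineFractionalAlgorithm n)
    (ht : 0 < t) (p : List (OrderedConstraint n)) (x y : Fin n) :
    MeasurableSet {X : Seed n t | (F.repairs p X).Adj x y} := by
  induction p using List.reverseRecOn with
  | nil => simp [F.repairs_nil]
  | append_singleton p O ih =>
    simp only [F.repairs_append, SimpleGraph.sup_adj, Set.ofPred_or]
    refine ih.union ?_
    simp only [OnlineFractionalAlgorithm.repair, SimpleGraph.fromEdgeSet_adj, Set.mem_image,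
      Set.mem_ofPred_eq, Set.ofPred_and, Set.ofPred_exists]
    refine MeasurableSet.inter (MeasurableSet.iUnion fun i => ?_) (MeasurableSet.const _)
    exact (F.measurableSet_uncovered ht _ O i).inter (MeasurableSet.const _)

lemma OnlineFractionalAlgorithm.satisfiedBy_repair (F : OnlineFractionalAlgorithm n)
    (q : List (OrderedConstraint n)) (O : OrderedConstraint n) (X : Seed n t) :
    O.SatisfiedBy (F.rounded q X ⊔ F.repair q O X) := by
  intro i hi
  by_cases h : X ∈ F.uncovered t q O i
  · have hlt : (⟨0, two_pos.trans_le O.two_le_len⟩ : Fin O.len) < i := hi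
    refine ⟨_, hlt, Or.inr ?_⟩
    rw [OnlineFractionalAlgorithm.repair, SimpleGraph.fromEdgeSet_adj]
    exact ⟨⟨i, h, rfl⟩, fun h => hlt.ne (O.node.injective h)⟩
  · have h' : ∃ j < i, (F.rounded q X).Adj (O.node j) (O.node i) := by
      by_contra hne
      push Not at hne
      exact h ⟨hi, hne⟩
    obtain ⟨j, hj, hadj⟩ := h'
    exact ⟨j, hj, Or.inl hadj⟩

lemma OnlineFractionalAlgorithm.feasible_rounded_sup_repairs (F : OnlineFractionalAlgorithm n)
    (p : List (OrderedConstraint n)) (X : Seed n t) :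
    Feasible p (F.rounded p X ⊔ F.repairs p X) := by
  induction p using List.reverseRecOn with
  | nil => simp [Feasible]
  | append_singleton p O ih =>
    rw [F.repairs_append]
    intro O' hO'
    rcases List.mem_append.1 hO' with h | h
    · exact (ih O' h).mono (sup_le_sup (F.rounded_le_append p O X) le_sup_left)
    · rw [List.mem_singleton.1 h]
      exact (F.satisfiedBy_repair (p ++ [O]) O X).mono (sup_le_sup le_rfl le_sup_right)

lemma OnlineFractionalAlgorithm.RoundingSucceeds.of_append {F : OnlineFractionalAlgorithm n}
    {p : List (OrderedConstraint n)} {O : OrderedConstraint n} {X : Seed n t}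
    (h : F.RoundingSucceeds (p ++ [O]) X) : F.RoundingSucceeds p X :=
  fun q hq => h q (hq.trans (List.prefix_append _ _))

lemma OnlineFractionalAlgorithm.RoundingSucceeds.repairs_eq_bot {F : OnlineFractionalAlgorithm n}
    {p : List (OrderedConstraint n)} {X : Seed n t} (h : F.RoundingSucceeds p X) :
    F.repairs p X = ⊥ := by
  induction p using List.reverseRecOn with
  | nil => exact F.repairs_nil X
  | append_singleton p O ih =>
    rw [F.repairs_append, ih h.of_append, bot_sup_eq, OnlineFractionalAlgorithm.repair]
    have : {i | X ∈ F.uncovered t (p ++ [O]) O i} = ∅ := by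
      ext i
      simp only [Set.mem_ofPred_eq, Set.mem_empty_iff_false, iff_false]
      rintro ⟨hi, hne⟩
      obtain ⟨j, hj, hadj⟩ := h _ List.prefix_rfl O (by simp) i hi
      exact hne j hj hadj
    simp [this]

lemma OnlineFractionalAlgorithm.roundingSucceeds_nil (F : OnlineFractionalAlgorithm n)
    (X : Seed n t) : F.RoundingSucceeds [] X := by
  intro q hq
  rw [List.prefix_nil.1 hq]
  simp [Feasible]

/-- Rounded solutions only grow, so older constraints stay satisfied. Hence each constraint has to
be checked only on arrival, and the union bound needs no sum over later times. -/
lemma OnlineFractionalAlgorithm.RoundingSucceeds.append {F : OnlineFractionalAlgorithm n}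
    {p : List (OrderedConstraint n)} {O : OrderedConstraint n} {X : Seed n t}
    (h : F.RoundingSucceeds p X) (hO : ∀ i, X ∉ F.uncovered t (p ++ [O]) O i) :
    F.RoundingSucceeds (p ++ [O]) X := by
  intro q hq
  rcases List.prefix_concat_iff.1 hq with rfl | hq
  · intro O' hO'
    rcases List.mem_append.1 hO' with h' | h'
    · exact (h p List.prefix_rfl O' h').mono (F.rounded_le_append p O X)
    · rw [List.mem_singleton.1 h']
      intro i hi
      by_contra hne
      push Not at hne
      exact hO i ⟨hi, hne⟩
  · exact h q hq

lemma sum_measureReal_uncovered_le (F : OnlineFractionalAlgorithm n) (ht : 0 < t)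
    (p : List (OrderedConstraint n)) (O : OrderedConstraint n) :
    ∑ i, volume.real (F.uncovered t (p ++ [O]) O i) ≤ n * Real.exp (-t) := by
  refine (Finset.sum_le_sum fun i _ => F.measureReal_uncovered_le ht (by simp) i).trans ?_
  rw [Finset.sum_const, Finset.card_univ, Fintype.card_fin, nsmul_eq_mul]
  exact mul_le_mul_of_nonneg_right (by exact_mod_cast O.len_le) (Real.exp_nonneg _)

lemma OnlineFractionalAlgorithm.measureReal_not_roundingSucceeds_le
    (F : OnlineFractionalAlgorithm n) (ht : 0 < t) (p : List (OrderedConstraint n)) :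
    (volume : Measure (Seed n t)).real {X | ¬ F.RoundingSucceeds p X} ≤
      p.length * (n * Real.exp (-t)) := by
  induction p using List.reverseRecOn with
  | nil => simp [F.roundingSucceeds_nil]
  | append_singleton p O ih =>
    have hsub : {X : Seed n t | ¬ F.RoundingSucceeds (p ++ [O]) X} ⊆
        {X | ¬ F.RoundingSucceeds p X} ∪ ⋃ i, F.uncovered t (p ++ [O]) O i := by
      intro X hX
      by_contra hne
      simp only [Set.mem_union, Set.mem_iUnion, not_or, Set.mem_ofPred_eq, not_not,
        not_exists] at hne
      exact hX (hne.1.append hne.2)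
    refine (measureReal_mono hsub).trans ((measureReal_union_le _ _).trans ?_)
    have h := (measureReal_iUnion_fintype_le (μ := (volume : Measure (Seed n t)))
      (fun i => F.uncovered t (p ++ [O]) O i)).trans (sum_measureReal_uncovered_le F ht p O)
    rw [List.length_append, List.length_singleton]
    push_cast
    linarith

/-! ### The cost of the algorithm -/

lemma cost_sup_le (G H : SimpleGraph (Fin n)) : cost (G ⊔ H) ≤ cost G + cost H := by
  rw [cost, SimpleGraph.edgeSet_sup]
  exact Set.ncard_union_le _ _

lemma OnlineFractionalAlgorithm.cost_repair_le (F : OnlineFractionalAlgorithm n)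
    (q : List (OrderedConstraint n)) (O : OrderedConstraint n) (X : Seed n t) :
    (cost (F.repair q O X) : ℝ) ≤ ∑ i, (F.uncovered t q O i).indicator 1 X := by
  classical
  have h : cost (F.repair q O X) ≤ (Finset.univ.filter fun i => X ∈ F.uncovered t q O i).card := by
    rw [cost, OnlineFractionalAlgorithm.repair, SimpleGraph.edgeSet_fromEdgeSet]
    refine (Set.ncard_le_ncard Set.sdiff_subset).trans ((Set.ncard_image_le).trans ?_)
    rw [← Set.ncard_coe_finset]
    simp
  refine (Nat.cast_le.2 h).trans ?_
  simp [Set.indicator_apply]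

/-- The expected number of repairs is at most `n * exp (-t)` for each constraint. -/
lemma OnlineFractionalAlgorithm.exists_integrable_cost_repairs_le
    (F : OnlineFractionalAlgorithm n) (ht : 0 < t) (p : List (OrderedConstraint n)) :
    ∃ Z : Seed n t → ℝ, Integrable Z ∧ (∀ X, (cost (F.repairs p X) : ℝ) ≤ Z X) ∧
      ∫ X, Z X ≤ p.length * (n * Real.exp (-t)) := by
  induction p using List.reverseRecOn with
  | nil => exact ⟨0, integrable_zero _ _ _, by simp [F.repairs_nil, cost], by simp⟩
  | append_singleton p O ih =>
    obtain ⟨Z, hZ, hcost, hint⟩ := ih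
    have hind : ∀ i, Integrable ((F.uncovered t (p ++ [O]) O i).indicator (1 : Seed n t → ℝ)) :=
      fun i => (integrable_const (1 : ℝ)).indicator (F.measurableSet_uncovered ht _ O i)
    have hsum := integrable_finsetSum Finset.univ fun i _ => hind i
    refine ⟨fun X => Z X + ∑ i, (F.uncovered t (p ++ [O]) O i).indicator 1 X, hZ.add hsum, ?_, ?_⟩
    · intro X
      rw [F.repairs_append]
      refine (Nat.cast_le.2 (cost_sup_le _ _)).trans ?_
      rw [Nat.cast_add]
      exact add_le_add (hcost X) (F.cost_repair_le _ O X)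
    · rw [integral_add hZ hsum, integral_finsetSum _ fun i _ => hind i]
      simp only [integral_indicator_one (F.measurableSet_uncovered ht (p ++ [O]) O _)]
      have := sum_measureReal_uncovered_le F ht p O
      rw [List.length_append, List.length_singleton]
      push_cast
      linarith

/-- The expected cost of the rounded solution is at most `t` times the fractional cost. -/
lemma OnlineFractionalAlgorithm.exists_integrable_cost_rounded_le
    (F : OnlineFractionalAlgorithm n) (ht : 0 < t) (p : List (OrderedConstraint n)) :
    ∃ Z : Seed n t → ℝ, Integrable Z ∧ (∀ X, (cost (F.rounded p X) : ℝ) ≤ Z X) ∧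
      ∫ X, Z X ≤ t * fracCost (F.orderedWeight p) := by
  classical
  let B : Sym2 (Fin n) → Set (Seed n t) := fun e => {X | threshold X e ≤ F.orderedWeight p e}
  have hB : ∀ e, MeasurableSet (B e) := fun e => measurableSet_threshold_le ht e _
  have hind : ∀ e, Integrable ((B e).indicator (1 : Seed n t → ℝ)) :=
    fun e => (integrable_const (1 : ℝ)).indicator (hB e)
  refine ⟨fun X => ∑ e ∈ (⊤ : SimpleGraph (Fin n)).edgeFinset, (B e).indicator 1 X,
    integrable_finsetSum _ fun e _ => hind e, fun X => ?_, ?_⟩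
  · have h : cost (F.rounded p X) ≤
        ((⊤ : SimpleGraph (Fin n)).edgeFinset.filter fun e => X ∈ B e).card := by
      rw [cost, ← Set.ncard_coe_finset]
      refine Set.ncard_le_ncard ?_ (Finset.finite_toSet _)
      intro e he
      rw [OnlineFractionalAlgorithm.rounded, SimpleGraph.edgeSet_fromEdgeSet] at he
      simp only [Finset.coe_filter, SimpleGraph.mem_edgeFinset, Set.mem_ofPred_eq]
      refine ⟨?_, he.1⟩
      simpa [SimpleGraph.edgeSet_top] using he.2
    refine (Nat.cast_le.2 h).trans ?_
    simp [Set.indicator_apply]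
  · rw [integral_finsetSum _ fun e _ => hind e, fracCost, Finset.mul_sum]
    refine Finset.sum_le_sum fun e _ => ?_
    rw [integral_indicator_one (hB e)]
    exact measureReal_threshold_le ht e (F.orderedWeight_nonneg p e)

/-- The edges whose weights have reached their thresholds, with all repairs. -/
noncomputable def OnlineFractionalAlgorithm.roundingAlgorithm (F : OnlineFractionalAlgorithm n) (ht : 0 < t) :
    RandomizedOnlineAlgorithm n (Seed n t) where
  graph p X := F.rounded p X ⊔ F.repairs p X
  mono p O X := by
    rw [F.repairs_append]
    exact sup_le_sup (F.rounded_le_append p O X) le_sup_left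
  feasible := F.feasible_rounded_sup_repairs
  measurable p G := by
    have h : {X : Seed n t | F.rounded p X ⊔ F.repairs p X = G} =
        ⋂ x, ⋂ y, {X | (F.rounded p X ⊔ F.repairs p X).Adj x y ↔ G.Adj x y} := by
      ext X
      simp only [Set.mem_ofPred_eq, Set.mem_iInter, SimpleGraph.ext_iff, funext_iff, eq_iff_iff]
    rw [h]
    refine MeasurableSet.iInter fun x => MeasurableSet.iInter fun y => ?_
    have hadj : MeasurableSet {X : Seed n t | (F.rounded p X ⊔ F.repairs p X).Adj x y} := by
      simp only [SimpleGraph.sup_adj, Set.ofPred_or]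
      exact (F.measurableSet_adj_rounded ht p x y).union (F.measurableSet_adj_repairs ht p x y)
    by_cases hG : G.Adj x y
    · simpa only [hG, iff_true] using hadj
    · simp only [hG, iff_false]
      exact hadj.compl

lemma OnlineFractionalAlgorithm.rounds_roundingAlgorithm (F : OnlineFractionalAlgorithm n)
    (ht : 0 < t) : (F.roundingAlgorithm ht).Rounds F :=
  fun p X => ⟨le_sup_left, fun h => by
    change F.rounded p X ⊔ F.repairs p X = _
    rw [h.repairs_eq_bot, sup_bot_eq]⟩

/-- There are finitely many graphs, so measurability of each event `graph p ω = G` suffices, and the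
cost is bounded. -/
lemma RandomizedOnlineAlgorithm.integrable_cost {Ω : Type} [MeasurableSpace Ω]
    (A : RandomizedOnlineAlgorithm n Ω) (μ : Measure Ω) [IsFiniteMeasure μ]
    (p : List (OrderedConstraint n)) : Integrable (fun ω => (cost (A.graph p ω) : ℝ)) μ := by
  let _ : MeasurableSpace (SimpleGraph (Fin n)) := ⊤
  have hmeas : Measurable (A.graph p) := measurable_to_countable' fun G => A.measurable p G
  have hcost : Measurable fun G : SimpleGraph (Fin n) => (cost G : ℝ) := measurable_from_top
  refine Integrable.of_bound (hcost.comp hmeas).aestronglyMeasurable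
    (Nat.card (Sym2 (Fin n)) : ℝ) (Filter.Eventually.of_forall fun ω => ?_)
  simp only [Real.norm_natCast, Nat.cast_le]
  exact Set.ncard_le_card _

/-! ### The fractional relaxation -/

/-- A graph that satisfies an ordered constraint solves the fractional relaxation. -/
lemma OrderedConstraint.SatisfiedBy.fracFeasible {O : OrderedConstraint n}
    {G : SimpleGraph (Fin n)} (h : O.SatisfiedBy G) {S : Finset (Fin n)}
    (hS : S ∈ O.connectivity) : FracFeasible (G.edgeSet.indicator 1) S := by
  obtain ⟨i, hi, rfl⟩ := OrderedConstraint.mem_connectivity.1 hS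
  have hind : ∀ e : Sym2 (Fin n), 0 ≤ G.edgeSet.indicator (1 : Sym2 (Fin n) → ℝ) e :=
    fun e => Set.indicator_nonneg (fun _ _ => zero_le_one) e
  set S := (Finset.Iic i).map O.node with hSdef
  have hroot : ∀ A ⊆ S, O.node ⟨0, hi.trans i.2⟩ ∈ A → (S \ A).Nonempty →
      1 ≤ ∑ e ∈ cutEdges S A, G.edgeSet.indicator (1 : Sym2 (Fin n) → ℝ) e := by
    intro A _ h0 ⟨v, hv⟩
    obtain ⟨hvS, hvA⟩ := Finset.mem_sdiff.1 hv
    obtain ⟨m, hm, rfl⟩ := Finset.mem_map.1 hvS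
    have hne : {j : Fin O.len | j ≤ i ∧ O.node j ∉ A}.Nonempty := ⟨m, Finset.mem_Iic.1 hm, hvA⟩
    -- The earliest node outside `A` has an earlier neighbour, which must lie in `A`; their edge
    -- crosses the cut.
    obtain ⟨k, hk, hmin⟩ := wellFounded_lt.has_min _ hne
    have hk0 : 0 < k.val := by
      by_contra hk0
      have : k = ⟨0, hi.trans i.2⟩ := Fin.ext (by simpa using hk0)
      exact hk.2 (this ▸ h0)
    obtain ⟨j, hj, hadj⟩ := h k hk0
    have hjA : O.node j ∈ A := by
      by_contra hjA
      exact hmin j ⟨hj.le.trans hk.1, hjA⟩ hj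
    have hmem : s(O.node j, O.node k) ∈ cutEdges S A := mem_cutEdges.2
      ⟨_, hjA, _, Finset.mem_sdiff.2 ⟨Finset.mem_map_of_mem _ (Finset.mem_Iic.2 hk.1), hk.2⟩, rfl⟩
    refine le_trans ?_ (Finset.single_le_sum (fun e _ => hind e) hmem)
    rw [Set.indicator_of_mem (by simpa using hadj)]
    simp
  refine fracFeasible_of_one_le_cut hind fun A hAS hA hA' => ?_
  by_cases h0 : O.node ⟨0, hi.trans i.2⟩ ∈ A
  · exact hroot A hAS h0 hA'
  · rw [← cutEdges_compl hAS]
    refine hroot _ Finset.sdiff_subset (Finset.mem_sdiff.2 ⟨Finset.mem_map_of_mem _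
      (Finset.mem_Iic.2 (Nat.zero_le _)), h0⟩) ?_
    rwa [Finset.sdiff_sdiff_eq_self hAS]

lemma fracCost_indicator_edgeSet (G : SimpleGraph (Fin n)) :
    fracCost (G.edgeSet.indicator 1) = cost G := by
  classical
  have h : G.edgeSet = ((⊤ : SimpleGraph (Fin n)).edgeFinset.filter fun e => e ∈ G.edgeSet :
      Finset (Sym2 (Fin n))) := by
    ext e
    simp only [Finset.coe_filter, SimpleGraph.mem_edgeFinset, Set.mem_ofPred_eq]
    exact ⟨fun h => ⟨SimpleGraph.edgeSet_mono le_top h, h⟩, fun h => h.2⟩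
  rw [cost]
  conv_rhs => rw [h, Set.ncard_coe_finset]
  simp [fracCost, Set.indicator_apply]

lemma exists_feasible_cost_eq_opt (p : List (OrderedConstraint n)) :
    ∃ G : SimpleGraph (Fin n), Feasible p G ∧ cost G = opt p := by
  refine Nat.sInf_mem (s := {k : ℕ | ∃ G : SimpleGraph (Fin n), Feasible p G ∧ cost G = k})
    ⟨_, ⊤, fun O _ i hi => ?_, rfl⟩
  have hlt : (⟨0, hi.trans i.2⟩ : Fin O.len) < i := hi
  exact ⟨_, hlt, fun h => hlt.ne (O.node.injective h)⟩

/-- The second node of a constraint can only be joined to the first. This lower bound absorbs the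
additive cost of the repairs into the ratio. -/
lemma one_le_opt {p : List (OrderedConstraint n)} (hp : p ≠ []) : 1 ≤ opt p := by
  obtain ⟨G, hG, hcost⟩ := exists_feasible_cost_eq_opt p
  obtain ⟨O, hO⟩ := List.exists_mem_of_ne_nil p hp
  obtain ⟨j, _, hadj⟩ := hG O hO ⟨1, O.two_le_len⟩ one_pos
  rw [← hcost, cost]
  exact (Set.ncard_pos (Set.toFinite _)).2 ⟨_, G.mem_edgeSet.2 hadj⟩

lemma OnlineFractionalAlgorithm.IsCompetitive.fracCost_orderedWeight_le
    {F : OnlineFractionalAlgorithm n} {c : ℝ} (hF : F.IsCompetitive c)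
    (p : List (OrderedConstraint n)) : fracCost (F.orderedWeight p) ≤ c * opt p := by
  obtain ⟨G, hG, hcost⟩ := exists_feasible_cost_eq_opt p
  rw [← hcost, ← fracCost_indicator_edgeSet]
  refine hF _ _ (fun e => Set.indicator_nonneg (fun _ _ => zero_le_one) e) fun S hS => ?_
  obtain ⟨O, hO, hSO⟩ := List.mem_flatMap.1 hS
  exact (hG O hO).fracFeasible hSO

lemma OnlineFractionalAlgorithm.IsCompetitive.integral_cost_le
    {F : OnlineFractionalAlgorithm n} {c : ℝ} (hF : F.IsCompetitive c) (ht : 0 < t)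
    (p : List (OrderedConstraint n)) :
    ∫ X, (cost ((F.roundingAlgorithm ht).graph p X) : ℝ) ≤
      t * (c * opt p) + p.length * (n * Real.exp (-t)) := by
  obtain ⟨Z₁, hint₁, hle₁, hbound₁⟩ := F.exists_integrable_cost_rounded_le ht p
  obtain ⟨Z₂, hint₂, hle₂, hbound₂⟩ := F.exists_integrable_cost_repairs_le ht p
  have h : ∀ X, (cost ((F.roundingAlgorithm ht).graph p X) : ℝ) ≤ Z₁ X + Z₂ X := by
    intro X
    refine (Nat.cast_le.2 (cost_sup_le _ _)).trans ?_
    rw [Nat.cast_add]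
    exact add_le_add (hle₁ X) (hle₂ X)
  refine (integral_mono (RandomizedOnlineAlgorithm.integrable_cost _ _ p)
    (hint₁.add hint₂) h).trans ?_
  have h1 : (t : ℝ) * fracCost (F.orderedWeight p) ≤ t * (c * opt p) :=
    mul_le_mul_of_nonneg_left (hF.fracCost_orderedWeight_le p) (Nat.cast_nonneg t)
  simp only [Pi.add_apply]
  rw [integral_add hint₁ hint₂]
  linarith

end NetworkConstruction

open NetworkConstruction
theorem theorem2 :
    ∃ K : ℝ, 0 < K ∧ ∀ c : ℝ, 1 < c → ∃ C : ℝ, 0 < C ∧ ∀ n : ℕ, 2 ≤ n →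
      ∃ F : OnlineFractionalAlgorithm n, F.IsCompetitive (K * Real.log n) ∧
        ∀ r : ℕ, 1 ≤ r → ∀ t : ℕ, t = ⌈c * (Real.log n + Real.log r)⌉₊ →
          ∃ A : RandomizedOnlineAlgorithm n (Seed n t),
            A.IsCompetitive volume r (C * ((Real.log r + Real.log n) * Real.log n)) ∧
            A.Rounds F ∧
            ∀ σ : List (OrderedConstraint n), σ.length = r →
              (volume : Measure (Seed n t)).real {X | ¬ F.RoundingSucceeds σ X} ≤
                ((r : ℝ) * n) ^ (1 - c) := by
  have hlog2 : 1 / 2 < Real.log 2 := lt_trans (by norm_num) Real.log_two_gt_d9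
  set K : ℝ := 4 / Real.log 2 with hK
  have hK0 : 0 < K := by positivity
  -- `K * (c + 2)` pays for the rounded edges, since `t ≤ (c + 2) * L`; the 4 pays for the repairs,
  -- since `L` and `log n` both exceed `1 / 2`.
  refine ⟨K, hK0, fun c hc => ⟨K * (c + 2) + 4, by positivity, fun n hn => ?_⟩⟩
  obtain ⟨F, hF⟩ := exists_competitive_fractional hn
  refine ⟨F, hF, fun r hr t ht_eq => ?_⟩
  have hn' : (2 : ℝ) ≤ n := by exact_mod_cast hn
  have hr' : (1 : ℝ) ≤ r := by exact_mod_cast hr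
  have hlogn : Real.log 2 ≤ Real.log n := Real.log_le_log (by norm_num) hn'
  have hlogr : 0 ≤ Real.log r := Real.log_nonneg hr'
  set L := Real.log r + Real.log n with hL
  have hLpos : 1 / 2 < L := by linarith
  have hLeq : Real.log n + Real.log r = L := add_comm _ _
  rw [hLeq] at ht_eq
  have ht : 0 < t := by
    rw [ht_eq, Nat.ceil_pos]
    positivity
  have hceil : c * L ≤ t := ht_eq ▸ Nat.le_ceil _
  -- The 1 lost to the ceiling is at most `2 * L`.
  have hceil' : (t : ℝ) ≤ (c + 2) * L := by
    have : (t : ℝ) < c * L + 1 := ht_eq ▸ Nat.ceil_lt_add_one (by positivity)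
    linarith
  have hrn : 1 ≤ (r : ℝ) * n := by nlinarith
  have hfail : (r : ℝ) * (n * Real.exp (-t)) ≤ ((r : ℝ) * n) ^ (1 - c) := by
    have hexp : Real.exp (-t) ≤ ((r : ℝ) * n) ^ (-c) := by
      rw [Real.rpow_def_of_pos (by linarith), Real.log_mul (by positivity) (by positivity)]
      refine Real.exp_le_exp.2 ?_
      linarith
    rw [sub_eq_add_neg, Real.rpow_add (by linarith), Real.rpow_one, ← mul_assoc]
    exact mul_le_mul_of_nonneg_left hexp (by linarith)
  refine ⟨F.roundingAlgorithm ht, fun σ hσ => ⟨RandomizedOnlineAlgorithm.integrable_cost _ _ σ,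
    ?_⟩, F.rounds_roundingAlgorithm ht, fun σ hσ => ?_⟩
  · have hopt : (1 : ℝ) ≤ opt σ := by
      exact_mod_cast one_le_opt (List.ne_nil_of_length_pos (by omega))
    have hone : ((r : ℝ) * n) ^ (1 - c) ≤ 1 :=
      Real.rpow_le_one_of_one_le_of_nonpos hrn (by linarith)
    have hmain := hF.integral_cost_le ht σ
    rw [hσ] at hmain
    have h1 : (t : ℝ) * (K * Real.log n * opt σ) ≤ (c + 2) * L * (K * Real.log n * opt σ) :=
      mul_le_mul_of_nonneg_right hceil' (by positivity)
    have h2 : 1 ≤ 4 * (L * Real.log n) := by nlinarith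
    have h3 : (1 : ℝ) * 1 ≤ 4 * (L * Real.log n) * opt σ :=
      mul_le_mul h2 hopt zero_le_one (by linarith)
    calc _ ≤ _ := hmain
      _ ≤ (c + 2) * L * (K * Real.log n * opt σ) + 4 * (L * Real.log n) * opt σ := by linarith
      _ = _ := by ring
  · exact (hσ ▸ F.measureReal_not_roundingSucceeds_le ht σ).trans hfail
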